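/- For $n\ge 3$ let $S_n$ be the graph of the convex polytope with vertex set $\{a_i,b_i,c_i,d_i : 1\le i\le n\}$ and edge set $\{a_ia_{i+1},\ b_ib_{i+1},\ c_ic_{i+1},\ d_id_{i+1},\ a_{i+1}b_i,\ a_ib_i,\ b_ic_i,\ c_id_i : 1\le i\le n\}$, where indices are taken modulo $n$. For a finite connected graph $G$ with distance $d$, a vertex $w$ strongly resolves two distinct vertices $u,v$ if $d(v,w)=d(v,u)+d(u,w)$ or $d(u,w)=d(u,v)+d(v,w)$; a set $S\subseteq V(G)$ is a strong resolving set if every two distinct vertices of $G$ are strongly resolved by some vertex of $S$; and the strong metric dimension $\mathrm{sdim}(G)$ is the minimum cardinality of a strong resolving set of $G$. Theorem. For every $n\ge 3$, $$\mathrm{sdim}(S_n)=\begin{cases} n, & n \text{ odd},\\ \frac{3n}{2}, & n\text{ even}.\end{cases}$$ -/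

import Mathlib

/-- The vertex `w` strongly resolves `u` and `v` in the (connected) graph `G`: `u` lies on a
shortest `v`-`w` path or `v` lies on a shortest `u`-`w` path. -/
def SimpleGraph.StronglyResolves {V : Type*} (G : SimpleGraph V) (w u v : V) : Prop :=
  G.dist v w = G.dist v u + G.dist u w ∨ G.dist u w = G.dist u v + G.dist v w

/-- A strong resolving set: every two distinct vertices are strongly resolved by some element. -/
def SimpleGraph.IsStrongResolvingSet {V : Type*} (G : SimpleGraph V) (S : Finset V) : Prop :=
  ∀ u v : V, u ≠ v → ∃ w ∈ S, G.StronglyResolves w u v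

/-- The strong metric dimension of a finite connected graph: the minimum cardinality of a strong
resolving set. -/
noncomputable def SimpleGraph.strongMetricDim {V : Type*} (G : SimpleGraph V) : ℕ :=
  sInf {k : ℕ | ∃ S : Finset V, G.IsStrongResolvingSet S ∧ S.card = k}

/-- The vertices `a_i, b_i, c_i, d_i` of the convex polytope `S_n`, indices modulo `n`. -/
inductive PolytopeSVertex (n : ℕ) : Type
  | a (i : ZMod n) : PolytopeSVertex n
  | b (i : ZMod n) : PolytopeSVertex n
  | c (i : ZMod n) : PolytopeSVertex n
  | d (i : ZMod n) : PolytopeSVertex n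

/-- The edges of `S_n`, each listed in one orientation: `a_i a_{i+1}`, `b_i b_{i+1}`,
`c_i c_{i+1}`, `d_i d_{i+1}`, `a_{i+1} b_i`, `a_i b_i`, `b_i c_i`, `c_i d_i`. -/
def PolytopeSEdge (n : ℕ) : PolytopeSVertex n → PolytopeSVertex n → Prop
  | .a i, .a j => j = i + 1
  | .b i, .b j => j = i + 1
  | .c i, .c j => j = i + 1
  | .d i, .d j => j = i + 1
  | .a j, .b i => j = i + 1 ∨ j = i
  | .b i, .c j => j = i
  | .c i, .d j => j = i
  | _, _ => False

/-- The graph of the convex polytope `S_n`. -/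
def polytopeS (n : ℕ) : SimpleGraph (PolytopeSVertex n) :=
  SimpleGraph.fromRel (PolytopeSEdge n)

namespace SimpleGraph

/-! All distances are explicit: a cyclic term plus the number of layers crossed, where a path
reaching the `a`-cycle gains from each `b i` having two neighbours there (`dist_eq_distFormula`).
Upper bound: a geodesic ending in an outer vertex extends radially to the `d`-cycle, so the `d l`
resolve every pair except antipodal pairs on the `a`-cycle. These exist only for even `n`, and half
of the `a`-cycle settles them. Lower bound: a pair whose geodesics extend at neither end must meet
every strong resolving set (`mem_or_mem_of_maximal`). For `n = 2k+1` the pairs `a i`, `d (i+k)` are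
`n` disjoint such pairs; for `n = 2k` the pairs `b i`, `d (i+k)` give `n`, and the antipodal pairs
on the `a`-cycle give `k` more. -/

theorem StronglyResolves.symm {V : Type*} {G : SimpleGraph V} {w u v : V}
    (h : G.StronglyResolves w u v) : G.StronglyResolves w v u :=
  Or.symm h

theorem stronglyResolves_left {V : Type*} (G : SimpleGraph V) (u v : V) :
    G.StronglyResolves u u v := by
  left
  simp

/-- A function that vanishes only at `u`, is 1-Lipschitz along edges and can always be decreased
along an edge is the distance from `u`. -/
theorem dist_eq_of_lipschitz_of_descent {V : Type*} {G : SimpleGraph V} {u : V} {f : V → ℕ}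
    (hu : f u = 0) (hlip : ∀ v w, G.Adj v w → f w ≤ f v + 1)
    (hdesc : ∀ v, v ≠ u → ∃ w, G.Adj w v ∧ f w + 1 = f v) (v : V) : G.dist u v = f v := by
  have hwalk : ∀ k v, f v = k → ∃ p : G.Walk u v, p.length = k := by
    intro k
    induction k with
    | zero =>
      intro v hv
      by_cases h : v = u
      · subst h
        exact ⟨.nil, rfl⟩
      · obtain ⟨w, -, hw⟩ := hdesc v h
        omega
    | succ k ih =>
      intro v hv
      have h : v ≠ u := by
        rintro rfl
        omega
      obtain ⟨w, hadj, hw⟩ := hdesc v h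
      obtain ⟨p, hp⟩ := ih w (by omega)
      exact ⟨p.concat hadj, by simp [hp]⟩
  have hlen : ∀ {x y : V} (p : G.Walk x y), f y ≤ f x + p.length := by
    intro x y p
    induction p with
    | nil => simp
    | cons h p ih =>
      have := hlip _ _ h
      simp only [Walk.length_cons]
      omega
  obtain ⟨p, hp⟩ := hwalk _ v rfl
  apply le_antisymm
  · exact hp ▸ dist_le p
  · obtain ⟨q, hq⟩ := p.reachable.exists_walk_length_eq_dist
    have := hlen q
    omega

theorem strongMetricDim_eq {V : Type*} {G : SimpleGraph V} {k : ℕ} (S : Finset V)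
    (hS : G.IsStrongResolvingSet S) (hcard : S.card ≤ k)
    (hlow : ∀ T : Finset V, G.IsStrongResolvingSet T → k ≤ T.card) :
    G.strongMetricDim = k := by
  have hk : S.card = k := le_antisymm hcard (hlow S hS)
  apply le_antisymm
  · exact Nat.sInf_le ⟨S, hS, hk⟩
  · refine le_csInf (Set.nonempty_of_mem (show k ∈ _ from ⟨S, hS, hk⟩)) ?_
    rintro _ ⟨T, hT, rfl⟩
    exact hlow T hT

end SimpleGraph

/-! ### Cyclic distances on `ZMod n` -/

namespace PolytopeS

variable {n : ℕ}

/-- The cyclic distance from `0` to `x`. -/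
def cyc (x : ZMod n) : ℕ := min x.val (n - x.val)

/-- The distance from `x` to the nearer of the two residues `0` and `-1`. -/
def halfCyc (x : ZMod n) : ℕ := min x.val (n - 1 - x.val)

theorem val_add_one_eq (hn : 3 ≤ n) (x : ZMod n) :
    (x + 1).val = if x.val + 1 = n then 0 else x.val + 1 := by
  have : NeZero n := ⟨by omega⟩
  have : Fact (1 < n) := ⟨by omega⟩
  have hx := x.val_lt
  rw [ZMod.val_add, ZMod.val_one]
  split_ifs with h
  · rw [h, Nat.mod_self]
  · exact Nat.mod_eq_of_lt (by omega)

theorem cyc_neg (x : ZMod n) : cyc (-x) = cyc x := by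
  obtain _ | n := n
  -- For `n = 0` truncated subtraction makes both sides zero.
  · simp [cyc]
  · have hx := x.val_lt
    rw [cyc, cyc, ZMod.neg_val]
    split_ifs with h
    · simp [h]
    · omega

theorem cyc_sub_comm (i j : ZMod n) : cyc (i - j) = cyc (j - i) := by
  rw [← cyc_neg, neg_sub]

theorem cyc_zero : cyc (0 : ZMod n) = 0 := by simp [cyc]

/-- Reflects that `b j` is adjacent to both `a j` and `a (j + 1)`: a path between it and the
`a`-cycle uses the nearer one. -/
theorem halfCyc_eq_min (hn : 3 ≤ n) (x : ZMod n) : halfCyc x = min (cyc x) (cyc (x + 1)) := by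
  have : NeZero n := ⟨by omega⟩
  have hx := x.val_lt
  have := val_add_one_eq hn x
  unfold halfCyc cyc
  split_ifs at this <;> omega

theorem cyc_le_cyc_add_one (hn : 3 ≤ n) (x : ZMod n) : cyc x ≤ cyc (x + 1) + 1 := by
  have : NeZero n := ⟨by omega⟩
  have hx := x.val_lt
  have := val_add_one_eq hn x
  unfold cyc
  split_ifs at this <;> omega

theorem cyc_add_one_le (hn : 3 ≤ n) (x : ZMod n) : cyc (x + 1) ≤ cyc x + 1 := by
  have : NeZero n := ⟨by omega⟩
  have hx := x.val_lt
  have := val_add_one_eq hn x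
  unfold cyc
  split_ifs at this <;> omega

theorem halfCyc_le_halfCyc_add_one (hn : 3 ≤ n) (x : ZMod n) :
    halfCyc x ≤ halfCyc (x + 1) + 1 := by
  have : NeZero n := ⟨by omega⟩
  have hx := x.val_lt
  have := val_add_one_eq hn x
  unfold halfCyc
  split_ifs at this <;> omega

theorem halfCyc_add_one_le (hn : 3 ≤ n) (x : ZMod n) : halfCyc (x + 1) ≤ halfCyc x + 1 := by
  have : NeZero n := ⟨by omega⟩
  have hx := x.val_lt
  have := val_add_one_eq hn x
  unfold halfCyc
  split_ifs at this <;> omega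

theorem cyc_descent (hn : 3 ≤ n) {x : ZMod n} (hx0 : x ≠ 0) :
    cyc (x + 1) + 1 = cyc x ∨ cyc (x - 1) + 1 = cyc x := by
  have : NeZero n := ⟨by omega⟩
  have hx := x.val_lt
  have hy := (x - 1).val_lt
  have h0 : x.val ≠ 0 := by rwa [Ne, ZMod.val_eq_zero]
  have h1 := val_add_one_eq hn x
  have h2 := val_add_one_eq hn (x - 1)
  rw [sub_add_cancel] at h2
  unfold cyc
  split_ifs at h1 h2 <;> omega

theorem two_mul_cyc_le (hn : 3 ≤ n) (x : ZMod n) : 2 * cyc x ≤ n := by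
  have : NeZero n := ⟨by omega⟩
  have := x.val_lt
  unfold cyc
  omega

theorem two_mul_halfCyc_lt (hn : 3 ≤ n) (x : ZMod n) : 2 * halfCyc x < n := by
  have : NeZero n := ⟨by omega⟩
  have := x.val_lt
  unfold halfCyc
  omega

theorem cyc_natCast_of_two_mul_le (hn : 3 ≤ n) {k : ℕ} (hk : 2 * k ≤ n) :
    cyc (k : ZMod n) = k := by
  unfold cyc
  rw [ZMod.val_cast_of_lt (by omega)]
  omega

theorem halfCyc_natCast_of_two_mul_lt {k : ℕ} (hk : 2 * k < n) :
    halfCyc (k : ZMod n) = k := by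
  unfold halfCyc
  rw [ZMod.val_cast_of_lt (by omega)]
  omega

/-! ### Distances in the polytope graph -/

open PolytopeSVertex

/-- The closed form of the distance in `polytopeS n`. -/
def distFormula : PolytopeSVertex n → PolytopeSVertex n → ℕ
  | a i, a j => cyc (j - i)
  | a i, b j => halfCyc (j - i) + 1
  | a i, c j => halfCyc (j - i) + 2
  | a i, d j => halfCyc (j - i) + 3
  | b i, a j => halfCyc (i - j) + 1
  | b i, b j => cyc (j - i)
  | b i, c j => cyc (j - i) + 1
  | b i, d j => cyc (j - i) + 2
  | c i, a j => halfCyc (i - j) + 2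
  | c i, b j => cyc (j - i) + 1
  | c i, c j => cyc (j - i)
  | c i, d j => cyc (j - i) + 1
  | d i, a j => halfCyc (i - j) + 3
  | d i, b j => cyc (j - i) + 2
  | d i, c j => cyc (j - i) + 1
  | d i, d j => cyc (j - i)

theorem distFormula_lipschitz (hn : 3 ≤ n) (u : PolytopeSVertex n) {v w : PolytopeSVertex n}
    (h : PolytopeSEdge n v w) :
    distFormula u w ≤ distFormula u v + 1 ∧ distFormula u v ≤ distFormula u w + 1 := by
  have e1 : ∀ i j : ZMod n, i + 1 - j = (i - j) + 1 := fun i j => by ring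
  have e2 : ∀ i j : ZMod n, i - j = (i - (j + 1)) + 1 := fun i j => by ring
  have hc : ∀ i j : ZMod n, cyc (i + 1 - j) ≤ cyc (i - j) + 1 ∧
      cyc (i - j) ≤ cyc (i + 1 - j) + 1 := fun i j => by
    rw [e1]
    exact ⟨cyc_add_one_le hn _, cyc_le_cyc_add_one hn _⟩
  have hh : ∀ i j : ZMod n, halfCyc (i + 1 - j) ≤ halfCyc (i - j) + 1 ∧
      halfCyc (i - j) ≤ halfCyc (i + 1 - j) + 1 := fun i j => by
    rw [e1]
    exact ⟨halfCyc_add_one_le hn _, halfCyc_le_halfCyc_add_one hn _⟩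
  have hh' : ∀ i j : ZMod n, halfCyc (i - (j + 1)) ≤ halfCyc (i - j) + 1 ∧
      halfCyc (i - j) ≤ halfCyc (i - (j + 1)) + 1 := fun i j => by
    rw [e2 i j]
    exact ⟨halfCyc_le_halfCyc_add_one hn _, halfCyc_add_one_le hn _⟩
  have hm : ∀ i j : ZMod n, halfCyc (i - j) = min (cyc (i - j)) (cyc (i + 1 - j)) :=
    fun i j => by rw [e1, halfCyc_eq_min hn]
  have hm' : ∀ i j : ZMod n, halfCyc (i - (j + 1)) = min (cyc (j - i)) (cyc (j + 1 - i)) :=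
    fun i j => by rw [halfCyc_eq_min hn, ← e2, cyc_sub_comm, cyc_sub_comm i j, min_comm]
  have hm'' : ∀ i j : ZMod n, halfCyc (i - j) = min (cyc (j - i)) (cyc (i + 1 - j)) :=
    fun i j => by rw [hm, cyc_sub_comm]
  rcases v with i | i | i | i <;> rcases w with j | j | j | j <;>
    simp only [PolytopeSEdge] at h
  case a.a | b.b | c.c | d.d =>
    subst h
    rcases u with s | s | s | s <;> simp only [distFormula] <;>
      have h1 := hc i s <;> have h2 := hh i s <;> have h3 := hh' s i <;> omega
  case a.b =>
    rcases h with rfl | rfl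
    · rcases u with s | s | s | s <;> simp only [distFormula] <;>
        have h1 := hc j s <;> have h2 := hm j s <;> have h3 := hm' s j <;> omega
    · rcases u with s | s | s | s <;> simp only [distFormula] <;>
        have h1 := hm i s <;> have h2 := hc i s <;> have h3 := hm'' s i <;>
        have h4 := hc s i <;> have h5 := cyc_sub_comm s i <;> omega
  case b.c | c.d =>
    subst h
    rcases u with s | s | s | s <;> simp only [distFormula] <;> omega

theorem adj_of_edge (hn : 3 ≤ n) {v w : PolytopeSVertex n} (h : PolytopeSEdge n v w) :
    (polytopeS n).Adj v w := by
  have : Fact (1 < n) := ⟨by omega⟩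
  rw [polytopeS, SimpleGraph.fromRel_adj]
  refine ⟨?_, Or.inl h⟩
  rintro rfl
  rcases v with i | i | i | i <;> simp [PolytopeSEdge] at h

theorem distFormula_self (v : PolytopeSVertex n) : distFormula v v = 0 := by
  rcases v with i | i | i | i <;> simp [distFormula, cyc_zero]

theorem distFormula_descent (hn : 3 ≤ n) (u v : PolytopeSVertex n) (huv : v ≠ u) :
    ∃ w, (polytopeS n).Adj w v ∧ distFormula u w + 1 = distFormula u v := by
  have hcyc : ∀ i j : ZMod n, j ≠ i →
      cyc (j + 1 - i) + 1 = cyc (j - i) ∨ cyc (j - 1 - i) + 1 = cyc (j - i) := fun i j hij => by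
    have := cyc_descent hn (sub_ne_zero.2 hij)
    rwa [show j + 1 - i = j - i + 1 by ring, show j - 1 - i = j - i - 1 by ring]
  have hfrom : ∀ i j : ZMod n,
      halfCyc (j - i) = cyc (j - i) ∨ halfCyc (j - i) = cyc (j + 1 - i) := fun i j => by
    rw [show j + 1 - i = j - i + 1 by ring, halfCyc_eq_min hn]
    exact min_choice _ _
  have hto : ∀ i j : ZMod n,
      halfCyc (i - j) = cyc (j - i) ∨ halfCyc (i - j) = cyc (j - 1 - i) := fun i j => by
    rw [cyc_sub_comm j i, cyc_sub_comm (j - 1) i, show i - (j - 1) = i - j + 1 by ring,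
      halfCyc_eq_min hn]
    exact min_choice _ _
  have haa : ∀ j, (polytopeS n).Adj (a j) (a (j + 1)) := fun j => adj_of_edge hn rfl
  have hbb : ∀ j, (polytopeS n).Adj (b j) (b (j + 1)) := fun j => adj_of_edge hn rfl
  have hcc : ∀ j, (polytopeS n).Adj (c j) (c (j + 1)) := fun j => adj_of_edge hn rfl
  have hdd : ∀ j, (polytopeS n).Adj (d j) (d (j + 1)) := fun j => adj_of_edge hn rfl
  have hab : ∀ j, (polytopeS n).Adj (a j) (b j) := fun j => adj_of_edge hn (Or.inr rfl)
  have hab' : ∀ j, (polytopeS n).Adj (a (j + 1)) (b j) := fun j => adj_of_edge hn (Or.inl rfl)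
  have hbc : ∀ j, (polytopeS n).Adj (b j) (c j) := fun j => adj_of_edge hn rfl
  have hcd : ∀ j, (polytopeS n).Adj (c j) (d j) := fun j => adj_of_edge hn rfl
  have hrot : ∀ (X : ZMod n → PolytopeSVertex n) (i j : ZMod n), X j ≠ X i →
      (∀ j, (polytopeS n).Adj (X j) (X (j + 1))) →
      (∀ j, distFormula (X i) (X j) = cyc (j - i)) →
      ∃ w, (polytopeS n).Adj w (X j) ∧ distFormula (X i) w + 1 = distFormula (X i) (X j) := by
    intro X i j hij hX hdist
    rcases hcyc i j (fun h => hij (h ▸ rfl)) with h | h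
    · exact ⟨X (j + 1), (hX j).symm, by rw [hdist, hdist, h]⟩
    · refine ⟨X (j - 1), ?_, by rw [hdist, hdist, h]⟩
      simpa using hX (j - 1)
  -- Here `k` is the number of layers from `u` to the `b`-cycle; the last step to `a j` comes from
  -- `b j` or `b (j - 1)`.
  have htoA : ∀ (u : PolytopeSVertex n) (i j : ZMod n) (k : ℕ),
      (∀ j, distFormula u (b j) = cyc (j - i) + k) →
      distFormula u (a j) = halfCyc (i - j) + k + 1 →
      ∃ w, (polytopeS n).Adj w (a j) ∧ distFormula u w + 1 = distFormula u (a j) := by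
    intro u i j k hb ha
    rcases hto i j with h | h
    · exact ⟨b j, (hab j).symm, by rw [hb, ha, h]⟩
    · refine ⟨b (j - 1), ?_, by rw [hb, ha, h]⟩
      simpa using (hab' (j - 1)).symm
  rcases u with i | i | i | i <;> rcases v with j | j | j | j
  case a.a => exact hrot a i j huv haa fun _ => rfl
  case b.b => exact hrot b i j huv hbb fun _ => rfl
  case c.c => exact hrot c i j huv hcc fun _ => rfl
  case d.d => exact hrot d i j huv hdd fun _ => rfl
  case b.a => exact htoA _ i j 0 (fun _ => rfl) rfl
  case c.a => exact htoA _ i j 1 (fun _ => rfl) rfl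
  case d.a => exact htoA _ i j 2 (fun _ => rfl) rfl
  case a.b =>
    rcases hfrom i j with h | h
    · exact ⟨a j, hab j, by simp only [distFormula, h]⟩
    · exact ⟨a (j + 1), hab' j, by simp only [distFormula, h]⟩
  case a.c | b.c => exact ⟨b j, hbc j, rfl⟩
  case a.d | b.d | c.d => exact ⟨c j, hcd j, rfl⟩
  case c.b | d.b => exact ⟨c j, (hbc j).symm, rfl⟩
  case d.c => exact ⟨d j, (hcd j).symm, rfl⟩

theorem dist_eq_distFormula (hn : 3 ≤ n) (u v : PolytopeSVertex n) :
    (polytopeS n).dist u v = distFormula u v := by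
  refine SimpleGraph.dist_eq_of_lipschitz_of_descent (distFormula_self u) ?_
    (fun v hv => distFormula_descent hn u v hv) v
  intro v w h
  rw [polytopeS, SimpleGraph.fromRel_adj] at h
  rcases h.2 with h | h
  · exact (distFormula_lipschitz hn u h).1
  · exact (distFormula_lipschitz hn u h).2

theorem distFormula_comm (hn : 3 ≤ n) (u v : PolytopeSVertex n) :
    distFormula u v = distFormula v u := by
  rw [← dist_eq_distFormula hn, ← dist_eq_distFormula hn, SimpleGraph.dist_comm]

theorem eq_of_distFormula_eq_zero {u v : PolytopeSVertex n} (hn : 3 ≤ n)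
    (h : distFormula u v = 0) : u = v := by
  by_contra huv
  obtain ⟨w, -, hw⟩ := distFormula_descent hn u v (Ne.symm huv)
  omega

theorem stronglyResolves_iff (hn : 3 ≤ n) (w u v : PolytopeSVertex n) :
    (polytopeS n).StronglyResolves w u v ↔
      distFormula v w = distFormula v u + distFormula u w ∨
        distFormula u w = distFormula u v + distFormula v w := by
  simp only [SimpleGraph.StronglyResolves, dist_eq_distFormula hn]

/-! ### Upper bound: what the `d`-cycle resolves -/

/-- Vertices `a_i` and `a_j` that are not antipodal are strongly resolved by some `d_l`. -/
theorem exists_d_stronglyResolves_a_a (hn : 3 ≤ n) {i j : ZMod n} (hij : 2 * cyc (j - i) ≠ n) :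
    ∃ l, (polytopeS n).StronglyResolves (d l) (a i) (a j) := by
  have key : ∀ i j : ZMod n, 2 * (j - i).val < n →
      ∃ l, (polytopeS n).StronglyResolves (d l) (a i) (a j) := by
    intro i j h
    have : NeZero n := ⟨by omega⟩
    -- The geodesic from `a j` descends to `a i` and must leave by `b (i - 1)`, on the far side; `b
    -- i` could be reached sooner from `a (i + 1)`.
    refine ⟨i - 1, (stronglyResolves_iff hn _ _ _).2 (Or.inl ?_)⟩
    simp only [distFormula]
    have h1 : halfCyc (i - 1 - i : ZMod n) = 0 := by
      rw [show i - 1 - i = (-1 : ZMod n) by ring, halfCyc_eq_min hn, neg_add_cancel, cyc_zero]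
      simp
    have h2 : halfCyc (i - 1 - j) = cyc (j - i) := by
      have e : i - 1 - j = -(j - i + 1) := by ring
      rw [halfCyc_eq_min hn, e, cyc_neg, show -(j - i + 1) + 1 = -(j - i) by ring, cyc_neg]
      have h3 := val_add_one_eq hn (j - i)
      have hlt := (j - i).val_lt
      unfold cyc
      split_ifs at h3 <;> omega
    rw [h1, h2, cyc_sub_comm]
  by_cases h : 2 * (j - i).val < n
  · exact key i j h
  · obtain ⟨l, hl⟩ := key j i (by
      have : NeZero n := ⟨by omega⟩
      have hlt := (j - i).val_lt
      have := ZMod.neg_val (j - i)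
      rw [neg_sub] at this
      unfold cyc at hij
      split_ifs at this <;> omega)
    exact ⟨l, hl.symm⟩

/-- Two vertices, not both of them on the `a`-cycle, are strongly resolved by some
`d_l`. -/
theorem exists_d_stronglyResolves (hn : 3 ≤ n) (u v : PolytopeSVertex n) :
    (∃ i j, u = a i ∧ v = a j) ∨ ∃ l, (polytopeS n).StronglyResolves (d l) u v := by
  rcases u with i | i | i | i <;> rcases v with j | j | j | j
  case a.a => exact Or.inl ⟨i, j, rfl, rfl⟩
  -- The witness lies in the column of the outer vertex (either one if the layers agree).
  all_goals
    right
    simp only [stronglyResolves_iff hn, distFormula]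
    have h := cyc_sub_comm i j
    first
    | (refine ⟨j, ?_⟩; simp only [sub_self, cyc_zero, or_true] <;> omega)
    | (refine ⟨i, ?_⟩; simp only [sub_self, cyc_zero, true_or])

theorem isStrongResolvingSet_of_d (hn : 3 ≤ n) {S : Finset (PolytopeSVertex n)}
    (hd : ∀ l, d l ∈ S)
    (ha : ∀ i j : ZMod n, 2 * cyc (j - i) = n → a i ∈ S ∨ a j ∈ S) :
    (polytopeS n).IsStrongResolvingSet S := by
  intro u v _
  rcases exists_d_stronglyResolves hn u v with ⟨i, j, rfl, rfl⟩ | ⟨l, hl⟩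
  · by_cases h : 2 * cyc (j - i) = n
    · rcases ha i j h with h | h
      · exact ⟨_, h, SimpleGraph.stronglyResolves_left _ _ _⟩
      · exact ⟨_, h, (SimpleGraph.stronglyResolves_left _ _ _).symm⟩
    · obtain ⟨l, hl⟩ := exists_d_stronglyResolves_a_a hn h
      exact ⟨_, hd l, hl⟩
  · exact ⟨_, hd l, hl⟩

/-! ### Lower bound: pairs with no extendable geodesic -/

/-- If no vertex other than `u`, `v` can prolong a geodesic between them at either end, then every
strong resolving set meets `{u, v}`. -/
theorem mem_or_mem_of_maximal (hn : 3 ≤ n) {S : Finset (PolytopeSVertex n)}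
    (hS : (polytopeS n).IsStrongResolvingSet S) {u v : PolytopeSVertex n}
    (h0 : distFormula u v ≠ 0)
    (h1 : ∀ w, distFormula u w ≤ distFormula u v ∨
      distFormula u w < distFormula u v + distFormula v w)
    (h2 : ∀ w, distFormula v w ≤ distFormula u v ∨
      distFormula v w < distFormula u v + distFormula u w) : u ∈ S ∨ v ∈ S := by
  have huv : u ≠ v := by
    rintro rfl
    exact h0 (distFormula_self u)
  obtain ⟨w, hw, hr⟩ := hS u v huv
  rw [stronglyResolves_iff hn, distFormula_comm hn v u] at hr
  rcases hr with hr | hr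
  · have h := h2 w
    have : u = w := eq_of_distFormula_eq_zero hn (by omega)
    exact Or.inl (this ▸ hw)
  · have h := h1 w
    have : v = w := eq_of_distFormula_eq_zero hn (by omega)
    exact Or.inr (this ▸ hw)

/-- The pair is diametral, the diameter being `k + 3`. -/
theorem a_mem_or_d_mem (hn : 3 ≤ n) {k : ℕ} (hk : n = 2 * k + 1)
    {S : Finset (PolytopeSVertex n)} (hS : (polytopeS n).IsStrongResolvingSet S) (i : ZMod n) :
    a i ∈ S ∨ d (i + (k : ZMod n)) ∈ S := by
  have e : distFormula (a i) (d (i + (k : ZMod n))) = k + 3 := by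
    simp only [distFormula, add_sub_cancel_left]
    rw [halfCyc_natCast_of_two_mul_lt (by omega)]
  have hc : ∀ x : ZMod n, cyc x ≤ k := fun x => by
    have := two_mul_cyc_le hn x
    omega
  have hh : ∀ x : ZMod n, halfCyc x ≤ k := fun x => by
    have := two_mul_halfCyc_lt hn x
    omega
  have hle : ∀ u v : PolytopeSVertex n, distFormula u v ≤ k + 3 := by
    intro u v
    rcases u with i | i | i | i <;> rcases v with j | j | j | j <;> simp only [distFormula] <;>
      have h1 := hc (j - i) <;> have h2 := hh (j - i) <;> have h3 := hh (i - j) <;> omega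
  apply mem_or_mem_of_maximal hn hS <;> rw [e]
  · omega
  · exact fun w => Or.inl (hle _ _)
  · exact fun w => Or.inl (hle _ _)

theorem b_mem_or_d_mem (hn : 3 ≤ n) {k : ℕ} (hk : n = 2 * k)
    {S : Finset (PolytopeSVertex n)} (hS : (polytopeS n).IsStrongResolvingSet S) (i : ZMod n) :
    b i ∈ S ∨ d (i + (k : ZMod n)) ∈ S := by
  have e : distFormula (b i) (d (i + (k : ZMod n))) = k + 2 := by
    simp only [distFormula, add_sub_cancel_left]
    rw [cyc_natCast_of_two_mul_le hn (by omega)]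
  have hc : ∀ x : ZMod n, cyc x ≤ k := fun x => by
    have := two_mul_cyc_le hn x
    omega
  have hh : ∀ x : ZMod n, halfCyc x < k := fun x => by
    have := two_mul_halfCyc_lt hn x
    omega
  apply mem_or_mem_of_maximal hn hS <;> rw [e]
  · omega
  · intro w
    left
    rcases w with j | j | j | j <;> simp only [distFormula] <;>
      have h1 := hc (j - i) <;> have h2 := hh (i - j) <;> omega
  · intro w
    left
    rcases w with j | j | j | j <;> simp only [distFormula] <;>
      have h1 := hc (j - (i + k)) <;> have h2 := hh (i + k - j) <;> omega

theorem a_mem_or_a_mem (hn : 3 ≤ n) {k : ℕ} (hk : n = 2 * k)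
    {S : Finset (PolytopeSVertex n)} (hS : (polytopeS n).IsStrongResolvingSet S) (i : ZMod n) :
    a i ∈ S ∨ a (i + (k : ZMod n)) ∈ S := by
  have e : distFormula (a i) (a (i + (k : ZMod n))) = k := by
    simp only [distFormula, add_sub_cancel_left]
    rw [cyc_natCast_of_two_mul_le hn (by omega)]
  have hc : ∀ x : ZMod n, cyc x ≤ k := fun x => by
    have := two_mul_cyc_le hn x
    omega
  have hh : ∀ x : ZMod n, halfCyc x < k := fun x => by
    have := two_mul_halfCyc_lt hn x
    omega
  -- This pair need not be diametral. For `w` off the `a`-cycle, both distances carry the same layer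
  -- term, and `halfCyc` stays below `k`, so the strict alternative holds.
  have hw : ∀ (i j : ZMod n) (w : PolytopeSVertex n), distFormula (a i) w ≤ k ∨
      distFormula (a i) w < k + distFormula (a j) w := by
    intro i j w
    rcases w with l | l | l | l <;> simp only [distFormula] <;>
      have h1 := hc (l - i) <;> have h2 := hh (l - i) <;> omega
  apply mem_or_mem_of_maximal hn hS <;> rw [e]
  · omega
  · exact hw _ _
  · exact hw _ _

/-! ### Counting -/

open Classical in
theorem strongMetricDim_of_odd (hn : 3 ≤ n) (hodd : Odd n) :
    (polytopeS n).strongMetricDim = n := by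
  obtain ⟨k, hk⟩ := hodd
  have : NeZero n := ⟨by omega⟩
  apply SimpleGraph.strongMetricDim_eq (Finset.univ.image d)
  · apply isStrongResolvingSet_of_d hn
    · simp
    · intro i j h
      omega
  · exact Finset.card_image_le.trans (by simp)
  · intro T hT
    -- Labels both members of the pair `a i`, `d (i + k)` by `i`; the values on `b` and `c` are
    -- arbitrary.
    let f : PolytopeSVertex n → ZMod n
      | a i => i
      | b i => i
      | c i => i
      | d i => i - k
    have hsub : (Finset.univ : Finset (ZMod n)) ⊆ T.image f := by
      intro i _
      rw [Finset.mem_image]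
      rcases a_mem_or_d_mem hn hk hT i with h | h
      · exact ⟨_, h, rfl⟩
      · exact ⟨_, h, add_sub_cancel_right _ _⟩
    simpa using (Finset.card_le_card hsub).trans Finset.card_image_le

open Classical in
theorem strongMetricDim_of_even (hn : 3 ≤ n) (heven : Even n) :
    (polytopeS n).strongMetricDim = 3 * n / 2 := by
  obtain ⟨k, hk'⟩ := heven
  have hk : n = 2 * k := by omega
  have : NeZero n := ⟨by omega⟩
  rw [show 3 * n / 2 = n + k by omega]
  apply SimpleGraph.strongMetricDim_eq
    (Finset.univ.image d ∪ (Finset.range k).image fun t : ℕ => a (t : ZMod n))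
  · apply isStrongResolvingSet_of_d hn
    · simp
    · intro i j h
      have hmem : ∀ i : ZMod n, i.val < k →
          a i ∈ Finset.univ.image d ∪ (Finset.range k).image fun t : ℕ => a (t : ZMod n) := by
        intro i hi
        refine Finset.mem_union_right _ (Finset.mem_image.2 ⟨i.val, by simpa using hi, ?_⟩)
        simp
      -- Of two antipodal residues, one has its representative below `k`.
      by_cases hi : i.val < k
      · exact Or.inl (hmem i hi)
      · refine Or.inr (hmem j ?_)
        have hi' := i.val_lt
        have hji : (j - i).val = k := by
          unfold cyc at h
          omega
        have hj : j.val = (k + i.val) % n := by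
          conv_lhs => rw [← sub_add_cancel j i, ZMod.val_add, hji]
        rw [hj, Nat.mod_eq_sub_mod (by omega), Nat.mod_eq_of_lt (by omega)]
        omega
  · refine (Finset.card_union_le _ _).trans (add_le_add ?_ ?_)
    · exact Finset.card_image_le.trans (by simp)
    · exact Finset.card_image_le.trans (by simp)
  · intro T hT
    let A := T.filter fun v => ∃ i, v = a i
    let B := T.filter fun v => ¬ ∃ i, v = a i
    let f : PolytopeSVertex n → ZMod n
      | a i => i
      | b i => i
      | c i => i
      | d i => i - k
    have hB : n ≤ B.card := by
      have hsub : (Finset.univ : Finset (ZMod n)) ⊆ B.image f := by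
        intro i _
        rw [Finset.mem_image]
        rcases b_mem_or_d_mem hn hk hT i with h | h
        · exact ⟨_, Finset.mem_filter.2 ⟨h, by simp⟩, rfl⟩
        · exact ⟨_, Finset.mem_filter.2 ⟨h, by simp⟩, add_sub_cancel_right _ _⟩
      simpa using (Finset.card_le_card hsub).trans Finset.card_image_le
    have hA : n ≤ A.card + A.card := by
      -- Each `a i` in `T` serves two residues, `i` and `i - k`.
      have hsub : (Finset.univ : Finset (ZMod n)) ⊆ A.image f ∪ A.image fun v => f v - k := by
        intro i _
        rw [Finset.mem_union, Finset.mem_image, Finset.mem_image]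
        rcases a_mem_or_a_mem hn hk hT i with h | h
        · exact Or.inl ⟨_, Finset.mem_filter.2 ⟨h, i, rfl⟩, rfl⟩
        · exact Or.inr ⟨_, Finset.mem_filter.2 ⟨h, _, rfl⟩, add_sub_cancel_right _ _⟩
      simpa using (Finset.card_le_card hsub).trans ((Finset.card_union_le _ _).trans
        (add_le_add Finset.card_image_le Finset.card_image_le))
    have hAB : A.card + B.card = T.card := Finset.card_filter_add_card_filter_not _
    omega

end PolytopeS

theorem theorem2 (n : ℕ) (hn : 3 ≤ n) :
    (Odd n → (polytopeS n).strongMetricDim = n) ∧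
      (Even n → (polytopeS n).strongMetricDim = 3 * n / 2) :=
  ⟨PolytopeS.strongMetricDim_of_odd hn, PolytopeS.strongMetricDim_of_even hn⟩
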